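/- **Theorem (Directional 4D spacetime uncertainty principle).** Let $\mathbb R^{3,1}$ have orthonormal basis $e_t,e_1,e_2,e_3$ with $-e_t^2=e_1^2=e_2^2=e_3^2=1$, let $G_{3,1}$ be its (16-dimensional, real) Clifford geometric algebra, put $i_3=e_1e_2e_3$, and let $|M|$ be the modulus of $M\in G_{3,1}$, i.e. $|M|^2$ is the sum of the squares of the 16 coefficients of $M$ in the basis of blades. Write spacetime vectors as $x=t\,e_t+\vec x$ and $\omega=\omega_t e_t+\vec\omega$ with $\vec x,\vec\omega\in\mathbb R^3$, let $\vec x\cdot\vec\omega$ be the Euclidean inner product of $\mathbb R^3$, $|x|^2=t^2+\vec x\cdot\vec x$ and $d^4x=dt\,dx\,dy\,dz$. The spacetime Fourier transform (SFT) of $f$ is $$\mathcal F\{f\}(\omega)=\int_{\mathbb R^{3,1}}e^{-e_t\,t\omega_t}\,f(x)\,e^{-i_3\,\vec x\cdot\vec\omega}\,d^4x$$ for integrable $f$; for $f\in L^2(\mathbb R^{3,1},G_{3,1})$ it is the limit in $L^2$, as $n\to\infty$, of the transforms of the truncations of $f$ to the balls $|x|\le n$. Let $f\in L^2(\mathbb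 R^{3,1},G_{3,1})$ with $|x|^{1/2}f\in L^2(\mathbb R^{3,1},G_{3,1})$. Then $\mathcal F\{f\}\in L^2$ exists, and for all spacetime vectors $a=a_te_t+\vec a$ and $b=b_te_t+\vec b$, $$\int_{\mathbb R^{3,1}}(a_tt-\vec a\cdot\vec x)^2|f(x)|^2\,d^4x\ \int_{\mathbb R^{3,1}}(b_t\omega_t-\vec b\cdot\vec\omega)^2|\mathcal F\{f\}(\omega)|^2\,d^4\omega\ \ge\ \frac{(2\pi)^4}{4}\Big[(a_tb_t+\vec a\cdot\vec b)^2F_-^2+(a_tb_t-\vec a\cdot\vec b)^2F_+^2\Big],$$ where the integrals on the left may be $+\infty$ (with $0\cdot\infty=0$), and $$F_\pm=\int_{\mathbb R^{3,1}}|f_\pm(x)|^2\,d^4x,\qquad f_\pm=\tfrac12\,(f\pm e_t\,f\,i_3)$$ are the energies of the two travelling wave-packet parts of $f$. -/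

import Mathlib

open MeasureTheory Filter Topology
open scoped ENNReal

noncomputable section

namespace STA

/-- The spacetime `ℝ^{3,1}` as a real vector space with Lebesgue measure `dt dx dy dz` and
`|x| = √(t² + x² + y² + z²)`. Coordinate `0` is time, coordinates `1, 2, 3` are space. -/
abbrev Spacetime : Type := EuclideanSpace ℝ (Fin 4)

/-- The quadratic form of `ℝ^{3,1}`: `-t² + x² + y² + z²`. -/
abbrev Q31 : QuadraticForm ℝ (Fin 4 → ℝ) :=
  QuadraticMap.weightedSumSquares ℝ (![-1, 1, 1, 1] : Fin 4 → ℝ)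

/-- The spacetime algebra `G_{3,1}`. -/
abbrev G31 : Type := CliffordAlgebra Q31

/-- The orthonormal basis vectors `e_t = e 0`, `e_1 = e 1`, `e_2 = e 2`, `e_3 = e 3`. -/
def e (i : Fin 4) : G31 := CliffordAlgebra.ι Q31 (Pi.single i 1)

/-- The time vector `e_t`. -/
def et : G31 := e 0

/-- The spatial volume element `i_3 = e_1 e_2 e_3`. -/
def i3 : G31 := e 1 * e 2 * e 3

/-- The basis blade `e_A`, the product of the basis vectors with index in `A` in increasing
order. -/
def blade (A : Finset (Fin 4)) : G31 :=
  (if 0 ∈ A then e 0 else 1) * ((if 1 ∈ A then e 1 else 1) *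
    ((if 2 ∈ A then e 2 else 1) * (if 3 ∈ A then e 3 else 1)))

/-! ### The blades form a basis -/

lemma e_sq (i : Fin 4) : e i * e i = algebraMap ℝ G31 ((![-1, 1, 1, 1] : Fin 4 → ℝ) i) := by
  unfold e
  rw [CliffordAlgebra.ι_sq_scalar]
  congr 1
  simp [QuadraticMap.weightedSumSquares_apply, Pi.single_apply]

lemma e_anticomm {i j : Fin 4} (h : i ≠ j) : e i * e j = -(e j * e i) := by
  unfold e
  apply CliffordAlgebra.ι_mul_ι_comm_of_isOrtho
  rw [QuadraticMap.isOrtho_def]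
  simp only [QuadraticMap.weightedSumSquares_apply, Pi.add_apply, Pi.single_apply]
  fin_cases i <;> fin_cases j <;> simp_all [Fin.sum_univ_four]

lemma e_sq_mul (i : Fin 4) (x : G31) :
    e i * (e i * x) = (![-1, 1, 1, 1] : Fin 4 → ℝ) i • x := by
  rw [← mul_assoc, e_sq, Algebra.smul_def]

lemma e_anticomm_mul {i j : Fin 4} (h : i ≠ j) (x : G31) :
    e i * (e j * x) = -(e j * (e i * x)) := by
  rw [← mul_assoc, e_anticomm h, neg_mul, mul_assoc]

lemma e_mul_blade_mem (i : Fin 4) (A : Finset (Fin 4)) :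
    e i * blade A ∈ Submodule.span ℝ (Set.range blade) := by
  have key : ∀ B : Finset (Fin 4), blade B ∈ Submodule.span ℝ (Set.range blade) :=
    fun B => Submodule.subset_span ⟨B, rfl⟩
  have h : e i * blade A = blade (symmDiff A {i}) ∨ e i * blade A = -blade (symmDiff A {i}) := by
    have h10 := e_anticomm (i := 1) (j := 0) (by decide)
    have h20 := e_anticomm (i := 2) (j := 0) (by decide)
    have h30 := e_anticomm (i := 3) (j := 0) (by decide)
    have h21 := e_anticomm (i := 2) (j := 1) (by decide)
    have h31 := e_anticomm (i := 3) (j := 1) (by decide)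
    have h32 := e_anticomm (i := 3) (j := 2) (by decide)
    have k10 := e_anticomm_mul (i := 1) (j := 0) (by decide)
    have k20 := e_anticomm_mul (i := 2) (j := 0) (by decide)
    have k30 := e_anticomm_mul (i := 3) (j := 0) (by decide)
    have k21 := e_anticomm_mul (i := 2) (j := 1) (by decide)
    have k31 := e_anticomm_mul (i := 3) (j := 1) (by decide)
    have k32 := e_anticomm_mul (i := 3) (j := 2) (by decide)
    unfold blade
    by_cases m0 : (0 : Fin 4) ∈ A <;> by_cases m1 : (1 : Fin 4) ∈ A <;>
    by_cases m2 : (2 : Fin 4) ∈ A <;> by_cases m3 : (3 : Fin 4) ∈ A <;>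
    fin_cases i <;>
    simp [Finset.mem_symmDiff, m0, m1, m2, m3, h10, h20, h30, h21, h31, h32, k10, k20, k30, k21,
      k31, k32, e_sq, e_sq_mul]
  rcases h with h | h
  · rw [h]; exact key _
  · rw [h]; exact Submodule.neg_mem _ (key _)

lemma span_blade : ⊤ ≤ Submodule.span ℝ (Set.range blade) := by
  have h1 : (1 : G31) ∈ Submodule.span ℝ (Set.range blade) :=
    Submodule.subset_span ⟨∅, by simp [blade]⟩
  have hι : ∀ (v : Fin 4 → ℝ), ∀ y ∈ Submodule.span ℝ (Set.range blade),
      CliffordAlgebra.ι Q31 v * y ∈ Submodule.span ℝ (Set.range blade) := by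
    intro v y hy
    have hv : CliffordAlgebra.ι Q31 v = ∑ i, v i • e i := by
      conv_lhs => rw [pi_eq_sum_univ' v]
      simp only [map_sum, map_smul, e]
    rw [hv, Finset.sum_mul]
    refine Submodule.sum_mem _ fun i _ => ?_
    rw [smul_mul_assoc]
    refine Submodule.smul_mem _ _ ?_
    induction hy using Submodule.span_induction with
    | mem x hx => obtain ⟨A, rfl⟩ := hx; exact e_mul_blade_mem i A
    | zero => simp
    | add x y _ _ hx hy => rw [mul_add]; exact Submodule.add_mem _ hx hy
    | smul c x _ hx => rw [mul_smul_comm]; exact Submodule.smul_mem _ _ hx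
  have hall : ∀ m : G31, ∀ y ∈ Submodule.span ℝ (Set.range blade),
      m * y ∈ Submodule.span ℝ (Set.range blade) := by
    intro m
    induction m using CliffordAlgebra.induction with
    | algebraMap r =>
      intro y hy
      rw [← Algebra.smul_def]
      exact Submodule.smul_mem _ _ hy
    | ι v => exact hι v
    | mul a b ha hb => intro y hy; rw [mul_assoc]; exact ha _ (hb _ hy)
    | add a b ha hb => intro y hy; rw [add_mul]; exact Submodule.add_mem _ (ha _ hy) (hb _ hy)
  intro m _
  simpa using hall m 1 h1

lemma linearIndependent_blade : LinearIndependent ℝ blade := by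
  refine linearIndependent_of_top_le_span_of_card_eq_finrank span_blade ?_
  rw [(CliffordAlgebra.equivExterior Q31).finrank_eq,
    Module.finrank_eq_card_basis (Pi.basisFun ℝ (Fin 4)).ExteriorAlgebra]

/-- The 16 blades as a real basis of `G_{3,1}`. -/
def bladeBasis : Module.Basis (Finset (Fin 4)) ℝ G31 :=
  Module.Basis.mk linearIndependent_blade span_blade

/-- The blade coefficients of a multivector, as a vector of Euclidean `ℝ^16`. -/
def coeffs : G31 ≃ₗ[ℝ] EuclideanSpace ℝ (Finset (Fin 4)) :=
  bladeBasis.equivFun.trans (WithLp.linearEquiv 2 ℝ (Finset (Fin 4) → ℝ)).symm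

/-- The modulus of a multivector: `|M|² = ∑_A M_A²`, the sum over all 16 blade coefficients. -/
instance : NormedAddCommGroup G31 :=
  NormedAddCommGroup.induced G31 (EuclideanSpace ℝ (Finset (Fin 4))) coeffs.toLinearMap
    coeffs.injective

instance : NormedSpace ℝ G31 :=
  NormedSpace.induced ℝ G31 (EuclideanSpace ℝ (Finset (Fin 4))) coeffs.toLinearMap

lemma norm_sq_eq (M : G31) : ‖M‖ ^ 2 = ∑ A, bladeBasis.repr M A ^ 2 := by
  have h : ‖M‖ = ‖coeffs M‖ := rfl
  rw [h, EuclideanSpace.real_norm_sq_eq]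
  rfl

instance : FiniteDimensional ℝ G31 := bladeBasis.finiteDimensional_of_finite

/-- Multiplication is continuous, so that the exponential series makes sense in `G_{3,1}`. -/
instance : IsTopologicalRing G31 where
  continuous_mul := by
    have h : Continuous fun p : G31 × G31 =>
        (LinearMap.toContinuousLinearMap
          (LinearMap.toContinuousLinearMap.toLinearMap ∘ₗ LinearMap.mul ℝ G31)) p.1 p.2 := by
      fun_prop
    exact h

/-! ### Spacetime Fourier transform -/

/-- The Euclidean inner product of the spatial parts of two spacetime vectors. -/
def sdot (x y : Spacetime) : ℝ := x 1 * y 1 + x 2 * y 2 + x 3 * y 3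

/-- The part `f_+ = (f + e_t f i_3) / 2`. -/
def plusPart (f : Spacetime → G31) (x : Spacetime) : G31 :=
  (1 / 2 : ℝ) • (f x + et * f x * i3)

/-- The part `f_- = (f - e_t f i_3) / 2`. -/
def minusPart (f : Spacetime → G31) (x : Spacetime) : G31 :=
  (1 / 2 : ℝ) • (f x - et * f x * i3)

/-- The spacetime Fourier integral of an integrable function. -/
def sftIntegral (f : Spacetime → G31) (ω : Spacetime) : G31 :=
  ∫ x : Spacetime, NormedSpace.exp (-((x 0 * ω 0) • et)) * f x *
    NormedSpace.exp (-(sdot x ω • i3))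

/-- `g` is (a representative of) the spacetime Fourier transform of the square integrable
function `f`: it is the limit in `L²` of the Fourier integrals of the truncations of `f` to the
balls `|x| ≤ n`, which are integrable. -/
def IsSFT (f g : Spacetime → G31) : Prop :=
  MemLp g 2 volume ∧
  Tendsto (fun n : ℕ =>
      eLpNorm (sftIntegral ((Metric.closedBall (0 : Spacetime) n).indicator f) - g) 2 volume)
    atTop (𝓝 0)

/-- The directional variance `∫ (a_t t - a⃗·x⃗)² |g(x)|² d⁴x`, possibly `∞`. -/
def dirVar (a : Spacetime) (g : Spacetime → G31) : ℝ≥0∞ :=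
  ∫⁻ x : Spacetime, ENNReal.ofReal ((a 0 * x 0 - sdot a x) ^ 2 * ‖g x‖ ^ 2)

/-- The energy `∫ |g(x)|² d⁴x` of a square integrable function. -/
def energy (g : Spacetime → G31) : ℝ := ∫ x : Spacetime, ‖g x‖ ^ 2

end STA

end

noncomputable section

namespace STA

/-! ### Multiplication by basis vectors is isometric -/

/-! Since `et` and `i3` both square to -1 and multiply isometrically, M ↦ e_t M i_3 is an isometric
involution. It splits f orthogonally into eigenparts for σ = ±1, and the transform respects the
splitting. On the σ-eigenspace M i_3 = -σ e_t M, so the right exponential moves to the left and the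
kernel becomes the single rotor e^{-e_t(tω_t - σ x⃗·ω⃗)} (`kernel_of_part`). With e_t as imaginary
unit this is an ordinary Fourier transform, so Plancherel holds with constant (2π)² in L² norm.

Translating an eigenpart by h rotates its transform by `phase σ h ω`. For h = `scaleSpace σ b` this
phase is b_tω_t - b⃗·ω⃗, so the b-spread of the transform bounds the L² speed of f along h
(`IsPart.eLpNorm_translate_sub_le`). A finite-difference commutator argument
(`abs_mul_integral_norm_sq_le`), which needs no derivatives, bounds the energy times |a_tb_t - σ
a⃗·b⃗| by that speed times twice the a-spread. Squaring gives the constant (2π)⁴/4 for each part;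
the two bounds add up because variances dominate the sums over parts. -/

/-- A signed permutation of an orthonormal basis is orthogonal; as σ is its own inverse, it also
reindexes the coefficient sums. -/
lemma norm_map_of_blade {T : G31 →ₗ[ℝ] G31} {σ : Finset (Fin 4) → Finset (Fin 4)}
    (hσ : Function.Involutive σ)
    (hT : ∀ A, T (blade A) = blade (σ A) ∨ T (blade A) = -blade (σ A)) (M : G31) :
    ‖T M‖ = ‖M‖ := by
  have hb : ∀ A, bladeBasis A = blade A := fun A => by simp [bladeBasis]
  have hε : ∀ A, ∃ ε : ℝ, ε ^ 2 = 1 ∧ T (bladeBasis A) = ε • bladeBasis (σ A) := fun A => by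
    rcases hT A with h | h
    · exact ⟨1, by norm_num, by rw [hb, hb, h, one_smul]⟩
    · exact ⟨-1, by norm_num, by rw [hb, hb, h, neg_one_smul]⟩
  choose ε hε1 hε2 using hε
  have hTM : T M = ∑ A, (bladeBasis.repr M (σ A) * ε (σ A)) • bladeBasis A := by
    conv_lhs => rw [← bladeBasis.sum_repr M]
    rw [map_sum, ← (Equiv.sum_comp hσ.toPerm)]
    refine Finset.sum_congr rfl fun A _ => ?_
    rw [Function.Involutive.coe_toPerm, map_smul, hε2, hσ A, smul_smul]
  have hrepr : ∀ A, bladeBasis.repr (T M) A = bladeBasis.repr M (σ A) * ε (σ A) := fun A => by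
    rw [hTM, bladeBasis.repr_sum_self]
  have hsq : ‖T M‖ ^ 2 = ‖M‖ ^ 2 := by
    rw [norm_sq_eq, norm_sq_eq, ← (Equiv.sum_comp hσ.toPerm)]
    refine Finset.sum_congr rfl fun A _ => ?_
    rw [Function.Involutive.coe_toPerm, hrepr, hσ A, mul_pow, hε1, mul_one]
  exact (sq_eq_sq₀ (norm_nonneg _) (norm_nonneg _)).1 hsq

lemma involutive_symmDiff_right (B : Finset (Fin 4)) :
    Function.Involutive fun A : Finset (Fin 4) => symmDiff A B :=
  fun A => symmDiff_symmDiff_cancel_right B A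

lemma et_mul_blade (A : Finset (Fin 4)) :
    et * blade A = blade (symmDiff A {0}) ∨ et * blade A = -blade (symmDiff A {0}) := by
  unfold blade et
  by_cases m0 : (0 : Fin 4) ∈ A
  · right
    simp only [Finset.mem_symmDiff, m0, if_true, e_sq_mul]
    simp [-mul_ite, -ite_mul]
  · left
    simp [Finset.mem_symmDiff, m0]

lemma blade_mul_i3 (A : Finset (Fin 4)) :
    blade A * i3 = blade (symmDiff A {1, 2, 3}) ∨
      blade A * i3 = -blade (symmDiff A {1, 2, 3}) := by
  have k21 := e_anticomm_mul (i := 2) (j := 1) (by decide)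
  have k31 := e_anticomm_mul (i := 3) (j := 1) (by decide)
  have k32 := e_anticomm_mul (i := 3) (j := 2) (by decide)
  unfold blade i3
  by_cases m0 : (0 : Fin 4) ∈ A <;> by_cases m1 : (1 : Fin 4) ∈ A <;>
  by_cases m2 : (2 : Fin 4) ∈ A <;> by_cases m3 : (3 : Fin 4) ∈ A <;>
  simp [Finset.mem_symmDiff, m0, m1, m2, m3, k21, k31, k32, e_sq, e_sq_mul, mul_assoc]

lemma norm_et_mul (M : G31) : ‖et * M‖ = ‖M‖ :=
  norm_map_of_blade (T := LinearMap.mulLeft ℝ et) (involutive_symmDiff_right {0}) et_mul_blade M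

lemma norm_mul_i3 (M : G31) : ‖M * i3‖ = ‖M‖ :=
  norm_map_of_blade (T := LinearMap.mulRight ℝ i3) (involutive_symmDiff_right {1, 2, 3})
    blade_mul_i3 M

lemma et_mul_et : et * et = -1 := by
  simp [et, e_sq]

lemma i3_mul_i3 : i3 * i3 = -1 := by
  have k21 := e_anticomm_mul (i := 2) (j := 1) (by decide)
  have k31 := e_anticomm_mul (i := 3) (j := 1) (by decide)
  have k32 := e_anticomm_mul (i := 3) (j := 2) (by decide)
  simp [i3, mul_assoc, k21, k31, k32, e_sq]

/-- Euler's formula for a square root of `-1` in the spacetime algebra. -/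
lemma exp_smul_of_sq_eq_neg_one {J : G31} (hJ : J * J = -1) (s : ℝ) :
    NormedSpace.exp (s • J) = Real.cos s • (1 : G31) + Real.sin s • J := by
  -- The algebra map ℂ → `G31` with I ↦ J is continuous by finite dimension, so it carries the
  -- exponential series and Euler's formula over from ℂ.
  let φ : ℂ →ₐ[ℝ] G31 := Complex.liftAux J hJ
  have hφc : Continuous φ := φ.toLinearMap.continuous_of_finiteDimensional
  have hφ : ∀ z : ℂ, φ z = z.re • (1 : G31) + z.im • J := fun z => by
    simp [φ, Complex.liftAux_apply, Algebra.algebraMap_eq_smul_one]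
  have h1 : s • J = φ (s * Complex.I) := by simp [hφ]
  have h2 : NormedSpace.exp (φ (s * Complex.I)) = φ (NormedSpace.exp (s * Complex.I)) := by
    have hs : HasSum (fun n : ℕ => ((n.factorial : ℝ)⁻¹) • (s * Complex.I) ^ n)
        (NormedSpace.exp ((s : ℂ) * Complex.I)) :=
      NormedSpace.exp_series_hasSum_exp' (𝕂 := ℝ) ((s : ℂ) * Complex.I)
    have := (hs.map φ hφc).tsum_eq
    rw [← this, NormedSpace.exp_eq_tsum ℝ]
    exact tsum_congr fun n => by rw [Function.comp_apply, map_smul φ, map_pow]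
  rw [h1, h2, ← Complex.exp_eq_exp_ℂ, hφ, Complex.exp_ofReal_mul_I_re,
    Complex.exp_ofReal_mul_I_im]

/-! ### The two parts of a multivector -/

/-- `(M + σ e_t M i_3) / 2` for a sign `σ`. -/
def part (σ : ℝ) : G31 →L[ℝ] G31 :=
  LinearMap.toContinuousLinearMap ((1 / 2 : ℝ) • (LinearMap.id +
    σ • (LinearMap.mulRight ℝ i3 ∘ₗ LinearMap.mulLeft ℝ et)))

lemma part_apply (σ : ℝ) (M : G31) : part σ M = (1 / 2 : ℝ) • (M + σ • (et * M * i3)) := rfl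

lemma plusPart_eq (f : Spacetime → G31) : plusPart f = fun x => part 1 (f x) := by
  ext x; simp [plusPart, part_apply]

lemma minusPart_eq (f : Spacetime → G31) : minusPart f = fun x => part (-1) (f x) := by
  ext x; simp [minusPart, part_apply, sub_eq_add_neg]

/-- Applying M ↦ e_t M i_3 twice gives (-1)M(-1) = M, so `part σ` projects onto its σ-eigenspace. -/
lemma et_mul_part_mul_i3 {σ : ℝ} (hσ : σ ^ 2 = 1) (M : G31) :
    et * part σ M * i3 = σ • part σ M := by
  have h : et * (et * M * i3) * i3 = M := by
    have : et * (et * M * i3) * i3 = (et * et) * M * (i3 * i3) := by noncomm_ring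
    rw [this, et_mul_et, i3_mul_i3]; simp
  simp only [part_apply, mul_add, add_mul, mul_smul_comm, smul_mul_assoc, h, smul_smul, smul_add]
  rw [add_comm]
  congr 2
  · ring
  · linear_combination (-1 / 2 : ℝ) * hσ

lemma part_add_part_neg (M : G31) : part 1 M + part (-1) M = M := by
  simp only [part_apply]
  module

lemma norm_coeffs (M : G31) : ‖coeffs M‖ = ‖M‖ := rfl

/-- Parallelogram law for M and e_t M i_3, which have equal norm. -/
lemma norm_sq_part_add (M : G31) : ‖part 1 M‖ ^ 2 + ‖part (-1) M‖ ^ 2 = ‖M‖ ^ 2 := by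
  have h := parallelogram_law_with_norm ℝ (coeffs M) (coeffs (et * M * i3))
  rw [← map_add, ← map_sub, norm_coeffs, norm_coeffs, norm_coeffs, norm_coeffs, norm_mul_i3,
    norm_et_mul] at h
  simp only [part_apply, norm_smul, one_smul, neg_smul, ← sub_eq_add_neg]
  norm_num
  nlinarith [h]

lemma norm_part_le {σ : ℝ} (hσ : |σ| = 1) (M : G31) : ‖part σ M‖ ≤ ‖M‖ := by
  have h := norm_add_le M (σ • (et * M * i3))
  rw [norm_smul, norm_mul_i3, norm_et_mul, Real.norm_eq_abs, hσ] at h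
  rw [part_apply, norm_smul]
  norm_num
  linarith

/-! ### The Fourier kernel -/

/-- The two-sided kernel `e^{-e_t s} M e^{-i_3 r}` of the spacetime Fourier transform. -/
def kernel (s r : ℝ) (M : G31) : G31 :=
  NormedSpace.exp (-(s • et)) * M * NormedSpace.exp (-(r • i3))

lemma kernel_eq (s r : ℝ) (M : G31) : kernel s r M =
    (Real.cos s • (1 : G31) - Real.sin s • et) * M *
      (Real.cos r • (1 : G31) - Real.sin r • i3) := by
  rw [kernel, ← neg_smul, ← neg_smul, exp_smul_of_sq_eq_neg_one et_mul_et,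
    exp_smul_of_sq_eq_neg_one i3_mul_i3]
  simp [sub_eq_add_neg]

lemma kernel_add (s r : ℝ) (M N : G31) : kernel s r (M + N) = kernel s r M + kernel s r N := by
  simp [kernel, mul_add, add_mul]

lemma kernel_sub (s r : ℝ) (M N : G31) : kernel s r (M - N) = kernel s r M - kernel s r N := by
  simp [kernel, mul_sub, sub_mul]

/-- The left factor is a polynomial in e_t and the right one in i_3, so both commute with the
involution. -/
lemma kernel_part (s r σ : ℝ) (M : G31) : kernel s r (part σ M) = part σ (kernel s r M) := by
  simp only [kernel_eq, part_apply, sub_mul, mul_sub, mul_add, add_mul, mul_smul_comm,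
    smul_mul_assoc, one_mul, mul_one, mul_assoc, smul_add, smul_sub]
  module

lemma continuous_kernel {X : Type*} [TopologicalSpace X] {s r : X → ℝ} {M : X → G31}
    (hs : Continuous s) (hr : Continuous r) (hM : Continuous M) :
    Continuous fun x => kernel (s x) (r x) (M x) := by
  simp only [kernel_eq]
  fun_prop

/-- Left multiplication by `e^{-e_t θ}`. -/
def rotor (θ : ℝ) : G31 →L[ℝ] G31 :=
  LinearMap.toContinuousLinearMap
    (LinearMap.mulLeft ℝ (Real.cos θ • (1 : G31) - Real.sin θ • et))

lemma rotor_apply (θ : ℝ) (M : G31) : rotor θ M = Real.cos θ • M - Real.sin θ • (et * M) := by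
  change (Real.cos θ • (1 : G31) - Real.sin θ • et) * M = _
  simp [sub_mul]

/-- The eigenvalue equation reads M i_3 = -σ e_t M, so right multiplication by e^{-i_3 r} equals
left multiplication by e^{σ e_t r}. -/
lemma kernel_of_part {σ : ℝ} (hσ : σ = 1 ∨ σ = -1) (s r : ℝ) {M : G31}
    (hM : et * M * i3 = σ • M) : kernel s r M = rotor (s - σ * r) M := by
  have h : M * i3 = -(σ • (et * M)) := by
    have : et * (et * M * i3) = -(M * i3) := by
      rw [← mul_assoc, ← mul_assoc, et_mul_et]; simp
    rw [← neg_eq_iff_eq_neg, ← this, hM, mul_smul_comm]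
  have h' : et * et * M = -M := by rw [et_mul_et]; simp
  rw [kernel_eq, rotor_apply]
  simp only [sub_mul, mul_sub, mul_smul_comm, smul_mul_assoc, one_mul, mul_one, mul_assoc, h,
    mul_neg, smul_neg]
  rw [← mul_assoc et et M, h']
  rcases hσ with rfl | rfl
  · simp only [one_mul, Real.cos_sub, Real.sin_sub]; module
  · simp only [neg_mul, one_mul, sub_neg_eq_add, Real.cos_add, Real.sin_add]; module

/-! ### Complex coordinates -/

/-- Coordinates in which left multiplication by `e_t` is multiplication by the imaginary unit. -/
def complexCoords : G31 →L[ℝ] EuclideanSpace ℂ (Finset (Fin 4)) :=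
  LinearMap.toContinuousLinearMap
    { toFun := fun M => WithLp.toLp 2 fun A =>
        (⟨bladeBasis.repr M A, -bladeBasis.repr (et * M) A⟩ : ℂ)
      map_add' := fun M N => by
        ext A; simp [Complex.ext_iff, mul_add]; ring
      map_smul' := fun c M => by
        ext A; simp [Complex.ext_iff] }

lemma complexCoords_apply (M : G31) (A : Finset (Fin 4)) :
    complexCoords M A = ⟨bladeBasis.repr M A, -bladeBasis.repr (et * M) A⟩ := rfl

/-- The coordinates are redundant: the imaginary parts repeat the norm of M through e_t M, hence √2.
-/
lemma norm_complexCoords (M : G31) : ‖complexCoords M‖ = √2 * ‖M‖ := by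
  have h : ‖complexCoords M‖ ^ 2 = (√2 * ‖M‖) ^ 2 := by
    rw [EuclideanSpace.norm_sq_eq, mul_pow, Real.sq_sqrt (by norm_num), two_mul]
    nth_rewrite 2 [← norm_et_mul]
    rw [norm_sq_eq, norm_sq_eq, ← Finset.sum_add_distrib]
    refine Finset.sum_congr rfl fun A _ => ?_
    rw [complexCoords_apply, Complex.sq_norm, Complex.normSq_mk]
    ring
  exact (sq_eq_sq₀ (norm_nonneg _) (by positivity)).1 h

lemma complexCoords_rotor (θ : ℝ) (M : G31) :
    complexCoords (rotor θ M) = Complex.exp (-(θ * Complex.I)) • complexCoords M := by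
  have h' : et * (et * M) = -M := by rw [← mul_assoc, et_mul_et]; simp
  have h : complexCoords (et * M) = Complex.I • complexCoords M := by
    ext A
    simp [complexCoords_apply, h', Complex.ext_iff]
  rw [rotor_apply, map_sub, map_smul, map_smul, h, ← neg_mul, Complex.exp_mul_I]
  ext A
  simp
  ring

lemma norm_rotor (θ : ℝ) (M : G31) : ‖rotor θ M‖ = ‖M‖ := by
  have h : √2 * ‖rotor θ M‖ = √2 * ‖M‖ := by
    rw [← norm_complexCoords, ← norm_complexCoords, complexCoords_rotor, norm_smul, ← neg_mul,
      ← Complex.ofReal_neg, Complex.norm_exp_ofReal_mul_I, one_mul]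
  exact mul_left_cancel₀ (by positivity) h

lemma norm_rotor_sub_le (θ : ℝ) (M : G31) : ‖rotor θ M - M‖ ≤ |θ| * ‖M‖ := by
  have h : √2 * ‖rotor θ M - M‖ ≤ √2 * (|θ| * ‖M‖) := by
    rw [← norm_complexCoords, map_sub, complexCoords_rotor]
    have h1 : Complex.exp (-(θ * Complex.I)) • complexCoords M - complexCoords M =
        (Complex.exp (Complex.I * ((-θ : ℝ) : ℂ)) - 1) • complexCoords M := by
      rw [sub_smul, one_smul]
      congr 3
      push_cast; ring
    rw [h1, norm_smul, norm_complexCoords, mul_left_comm]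
    gcongr
    simpa using Real.norm_exp_I_mul_ofReal_sub_one_le (x := -θ)
  exact le_of_mul_le_mul_left h (by positivity)

/-- Each part is rotated isometrically. The 2 comes from the triangle inequality and suffices for
domination. -/
lemma norm_kernel_le (s r : ℝ) (M : G31) : ‖kernel s r M‖ ≤ 2 * ‖M‖ := by
  have h := part_add_part_neg M
  have h1 := kernel_of_part (Or.inl rfl) s r (et_mul_part_mul_i3 (σ := 1) (by norm_num) M)
  have h2 := kernel_of_part (Or.inr rfl) s r (et_mul_part_mul_i3 (σ := -1) (by norm_num) M)
  calc ‖kernel s r M‖ = ‖kernel s r (part 1 M) + kernel s r (part (-1) M)‖ := by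
        rw [← kernel_add, h]
    _ ≤ ‖part 1 M‖ + ‖part (-1) M‖ := by
        rw [h1, h2]
        refine (norm_add_le _ _).trans ?_
        rw [norm_rotor, norm_rotor]
    _ ≤ 2 * ‖M‖ := by
        rw [two_mul]
        exact add_le_add (norm_part_le (by simp) M) (norm_part_le (by simp) M)

/-! ### L² norms under dilation and translation. -/

section ChangeOfVariables

variable {E F : Type*} [NormedAddCommGroup E] [InnerProductSpace ℝ E] [FiniteDimensional ℝ E]
  [MeasurableSpace E] [BorelSpace E] [NormedAddCommGroup F]

lemma eLpNorm_comp_smul (u : E → F) {c : ℝ} (hc : 0 < c) :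
    eLpNorm (fun x => u (c⁻¹ • x)) 2 volume =
      ENNReal.ofReal (√(c ^ Module.finrank ℝ E)) * eLpNorm u 2 volume := by
  have hc0 : c⁻¹ ≠ 0 := (inv_pos.2 hc).ne'
  have h : eLpNorm (u ∘ fun x => c⁻¹ • x) 2 volume =
      eLpNorm u 2 (Measure.map (fun x : E => c⁻¹ • x) volume) :=
    ((Homeomorph.smulOfNeZero c⁻¹ hc0).measurableEmbedding.eLpNorm_map_measure).symm
  change eLpNorm (u ∘ fun x => c⁻¹ • x) 2 volume = _
  rw [h, Measure.map_addHaar_smul _ hc0, eLpNorm_smul_measure_of_ne_top (by norm_num), smul_eq_mul]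
  congr 1
  rw [inv_pow, inv_inv, abs_of_pos (by positivity), ENNReal.ofReal_rpow_of_pos (by positivity),
    Real.sqrt_eq_rpow]
  norm_num

lemma memLp_comp_add_right {u : E → F} (hu : MemLp u 2) (h : E) :
    MemLp (fun x => u (x + h)) 2 :=
  hu.comp_measurePreserving (measurePreserving_add_right volume h)

lemma eLpNorm_comp_add_right {u : E → F} (hu : AEStronglyMeasurable u) (h : E) :
    eLpNorm (fun x => u (x + h)) 2 = eLpNorm u 2 :=
  eLpNorm_comp_measurePreserving hu (measurePreserving_add_right volume h)

end ChangeOfVariables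

/-! ### Plancherel for the Fourier integral on L¹ ∩ L². -/

section Plancherel

open FourierTransform SchwartzMap
open scoped ContDiff

variable {E F : Type*} [NormedAddCommGroup E] [InnerProductSpace ℝ E] [FiniteDimensional ℝ E]
  [MeasurableSpace E] [BorelSpace E]
  [NormedAddCommGroup F] [InnerProductSpace ℂ F]

lemma continuous_fourier_of_integrable {u : E → F} (hu : Integrable u) :
    Continuous (𝓕 u) :=
  VectorFourier.fourierIntegral_continuous Real.continuous_fourierChar
    (innerSL ℝ).continuous₂ hu

variable [CompleteSpace F]

/-- On `L¹ ∩ L²` the `L²` Fourier transform is given by the Fourier integral. -/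
theorem fourier_toLp_ae_eq {u : E → F} (hu : Integrable u) (hu2 : MemLp u 2) :
    (𝓕 (hu2.toLp u) : Lp (α := E) F 2) =ᵐ[volume] 𝓕 u := by
  -- Tested against a smooth compactly supported φ, both sides equal ∫ 𝓕φ • u: one by duality for
  -- tempered distributions, the other by the exchange formula for Fourier integrals.
  refine ae_eq_of_integral_contDiff_smul_eq
    ((Lp.memLp _).locallyIntegrable (by norm_num))
    (continuous_fourier_of_integrable hu).locallyIntegrable fun g hg hgc => ?_
  have hg₁ : HasCompactSupport (Complex.ofRealCLM ∘ g) := hgc.comp_left rfl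
  have hg₂ : ContDiff ℝ ∞ (Complex.ofRealCLM ∘ g) := by fun_prop
  let φ : 𝓢(E, ℂ) := hg₁.toSchwartzMap hg₂
  have hφ : ∀ x, φ x = (g x : ℂ) := fun x => rfl
  have h1 := congrArg (fun T : 𝓢'(E, F) => T φ)
    (Lp.fourier_toTemperedDistribution_eq (hu2.toLp u))
  simp only [TemperedDistribution.fourier_apply, Lp.toTemperedDistribution_apply] at h1
  have h2 : ∫ x, (𝓕 φ) x • (hu2.toLp u) x = ∫ x, (𝓕 (φ : E → ℂ)) x • u x := by
    refine integral_congr_ae ?_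
    filter_upwards [hu2.coeFn_toLp] with x hx
    rw [hx]; rfl
  have h3 : ∫ x, (𝓕 (φ : E → ℂ)) x • u x = ∫ x, φ x • (𝓕 u) x := by
    have := VectorFourier.integral_fourierIntegral_smul_eq_flip (μ := volume) (ν := volume)
      (L := innerₗ E) Real.continuous_fourierChar continuous_inner φ.integrable hu
    rwa [flip_innerₗ] at this
  rw [h2, h3] at h1
  simp only [hφ, Complex.coe_smul] at h1
  exact h1.symm

/-- Plancherel's theorem on `L¹ ∩ L²`. -/
theorem eLpNorm_fourier_eq {u : E → F} (hu : Integrable u) (hu2 : MemLp u 2) :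
    eLpNorm (𝓕 u) 2 volume = eLpNorm u 2 volume := by
  rw [← eLpNorm_congr_ae (fourier_toLp_ae_eq hu hu2), ← eLpNorm_congr_ae hu2.coeFn_toLp,
    ← Lp.enorm_def, ← Lp.enorm_def, ← ofReal_norm, ← ofReal_norm, Lp.norm_fourier_eq]

end Plancherel

/-! ### An uncertainty principle from finite translations. -/

section Uncertainty

open scoped RealInnerProductSpace

variable {V F : Type*} [NormedAddCommGroup V] [InnerProductSpace ℝ V] [FiniteDimensional ℝ V]
  [MeasurableSpace V] [BorelSpace V] [NormedAddCommGroup F] [InnerProductSpace ℝ F]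

lemma integrable_inner_of_memLp {u v : V → F} (hu : MemLp u 2) (hv : MemLp v 2) :
    Integrable fun x => ⟪u x, v x⟫ := by
  refine (L2.integrable_inner (𝕜 := ℝ) (hu.toLp u) (hv.toLp v)).congr ?_
  filter_upwards [hu.coeFn_toLp, hv.coeFn_toLp] with x h1 h2
  rw [h1, h2]

lemma abs_integral_inner_le {u v : V → F} (hu : MemLp u 2) (hv : MemLp v 2) :
    |∫ x, ⟪u x, v x⟫| ≤ (eLpNorm u 2).toReal * (eLpNorm v 2).toReal := by
  have h : ⟪hu.toLp u, hv.toLp v⟫ = ∫ x, ⟪u x, v x⟫ := by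
    rw [L2.inner_def]
    refine integral_congr_ae ?_
    filter_upwards [hu.coeFn_toLp, hv.coeFn_toLp] with x h1 h2
    rw [h1, h2]
  rw [← h, ← Lp.norm_toLp u hu, ← Lp.norm_toLp v hv]
  exact abs_real_inner_le_norm _ _

/-- The commutator identity behind the uncertainty principle. -/
lemma mul_integral_inner_translate {u : V → F} (α : V →L[ℝ] ℝ) (hu : MemLp u 2)
    (hαu : MemLp (fun x => α x • u x) 2) (h : V) :
    α h * ∫ x, ⟪u x, u (x + h)⟫ =
      (∫ x, ⟪α x • u x, u (x + -h) - u x⟫) - ∫ x, ⟪α x • u x, u (x + h) - u x⟫ := by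
  have hp := memLp_comp_add_right hu h
  have hm := memLp_comp_add_right hu (-h)
  have hαp := memLp_comp_add_right hαu h
  -- The same integral is evaluated twice, by translating and by α(x + h) = α x + α h. Comparison
  -- isolates α h, a discrete form of the commutator of α with the derivative along h.
  have h1 : ∫ x, ⟪u x, α (x + h) • u (x + h)⟫ = ∫ x, ⟪α x • u x, u (x + -h)⟫ := by
    rw [← integral_add_right_eq_self (fun x => ⟪α x • u x, u (x + -h)⟫) h]
    refine integral_congr_ae (ae_of_all _ fun x => ?_)
    simp only [add_neg_cancel_right]
    exact real_inner_comm _ _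
  have h2 : ∫ x, ⟪u x, α (x + h) • u (x + h)⟫ =
      (∫ x, ⟪α x • u x, u (x + h)⟫) + α h * ∫ x, ⟪u x, u (x + h)⟫ := by
    rw [← integral_const_mul, ← integral_add (integrable_inner_of_memLp hαu hp)
      ((integrable_inner_of_memLp hu hp).const_mul _)]
    refine integral_congr_ae (ae_of_all _ fun x => ?_)
    simp only [map_add, real_inner_smul_left, real_inner_smul_right]
    ring
  simp only [inner_sub_right]
  rw [integral_sub (integrable_inner_of_memLp hαu hm) (integrable_inner_of_memLp hαu hu),
    integral_sub (integrable_inner_of_memLp hαu hp) (integrable_inner_of_memLp hαu hu), ← h1, h2]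
  ring

/-- An uncertainty principle for translations: if `u` moves with `L²` speed at most `C` in the
direction `h`, then the spread of `u` along a linear form `α` is bounded below. -/
theorem abs_mul_integral_norm_sq_le {u : V → F} (α : V →L[ℝ] ℝ) (hu : MemLp u 2)
    (hαu : MemLp (fun x => α x • u x) 2) (h : V) {C : ℝ}
    (hC : ∀ s : ℝ, (eLpNorm (fun x => u (x + s • h) - u x) 2).toReal ≤ |s| * C) :
    |α h| * ∫ x, ‖u x‖ ^ 2 ≤ 2 * (C * (eLpNorm (fun x => α x • u x) 2).toReal) := by
  set X := (eLpNorm (fun x => α x • u x) 2).toReal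
  set N := (eLpNorm u 2).toReal
  have hX : 0 ≤ X := ENNReal.toReal_nonneg
  have hN : 0 ≤ N := ENNReal.toReal_nonneg
  have hd : ∀ s : ℝ, MemLp (fun x => u (x + s • h) - u x) 2 := fun s =>
    (memLp_comp_add_right hu (s • h)).sub hu
  -- The factor 2 comes from the translations by s h and -s h. Replacing ∫⟪u, u(· + s h)⟫ by ∫‖u‖²
  -- costs an error linear in s, which vanishes as s → 0⁺.
  have key : ∀ s : ℝ, 0 < s →
      |α h| * ∫ x, ‖u x‖ ^ 2 ≤ 2 * (C * X) + |α h| * (N * C) * s := by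
    intro s hs
    have h1 := mul_integral_inner_translate α hu hαu (s • h)
    have h2 := abs_integral_inner_le hαu (hd s)
    have h3 := abs_integral_inner_le hαu (hd (-s))
    have h4 := abs_integral_inner_le hu (hd s)
    have h5 : ∫ x, ⟪u x, u (x + s • h) - u x⟫ =
        (∫ x, ⟪u x, u (x + s • h)⟫) - ∫ x, ‖u x‖ ^ 2 := by
      simp only [inner_sub_right, ← real_inner_self_eq_norm_sq]
      exact integral_sub (integrable_inner_of_memLp hu (memLp_comp_add_right hu (s • h)))
        (integrable_inner_of_memLp hu hu)
    simp only [neg_smul] at h3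
    have c1 := hC s
    have c2 := hC (-s)
    simp only [neg_smul] at c2
    rw [abs_neg] at c2
    rw [abs_of_pos hs] at c1 c2
    have h2' := h2.trans (mul_le_mul_of_nonneg_left c1 hX)
    have h3' := h3.trans (mul_le_mul_of_nonneg_left c2 hX)
    have h4' := h4.trans (mul_le_mul_of_nonneg_left c1 hN)
    set I := ∫ x, ⟪u x, u (x + s • h)⟫
    set S := ∫ x, ‖u x‖ ^ 2
    have h6 : s * (|α h| * |I|) ≤ s * (2 * (C * X)) := by
      have : |α (s • h) * I| = s * (|α h| * |I|) := by
        rw [map_smul, smul_eq_mul, abs_mul, abs_mul, abs_of_pos hs, mul_assoc]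
      rw [← this, h1]
      refine (abs_sub _ _).trans ?_
      linarith
    have h7 := le_of_mul_le_mul_left h6 hs
    have h8 : S ≤ |I| + N * C * s := by
      rw [h5] at h4'
      have := (abs_le.1 h4').1
      have := le_abs_self I
      linarith
    calc |α h| * S ≤ |α h| * (|I| + N * C * s) := by gcongr
      _ ≤ _ := by linarith
  have ht : Tendsto (fun s : ℝ => 2 * (C * X) + |α h| * (N * C) * s) (𝓝[>] 0)
      (𝓝 (2 * (C * X) + |α h| * (N * C) * 0)) :=
    (Continuous.tendsto (by fun_prop) 0).mono_left nhdsWithin_le_nhds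
  rw [mul_zero, add_zero] at ht
  exact ge_of_tendsto ht (eventually_nhdsWithin_of_forall fun s hs => key s hs)

end Uncertainty

/-! ### Square integrable functions -/

lemma eLpNorm_two_sq {X F : Type*} [MeasurableSpace X] {μ : Measure X} [NormedAddCommGroup F]
    (u : X → F) : eLpNorm u 2 μ ^ 2 = ∫⁻ x, ‖u x‖ₑ ^ 2 ∂μ := by
  rw [eLpNorm_eq_lintegral_rpow_enorm_toReal (by norm_num) (by norm_num)]
  simp only [ENNReal.toReal_ofNat, ENNReal.rpow_ofNat]
  rw [← ENNReal.rpow_natCast, ← ENNReal.rpow_mul]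
  norm_num

/-- The truncation of `f` to the ball `|x| ≤ n`. -/
def truncate (n : ℕ) (f : Spacetime → G31) : Spacetime → G31 :=
  (Metric.closedBall (0 : Spacetime) n).indicator f

lemma memLp_truncate {f : Spacetime → G31} (hf : MemLp f 2) (n : ℕ) : MemLp (truncate n f) 2 :=
  hf.indicator Metric.isClosed_closedBall.measurableSet

lemma integrable_truncate {f : Spacetime → G31} (hf : MemLp f 2) (n : ℕ) :
    Integrable (truncate n f) := by
  refine (integrable_indicator_iff Metric.isClosed_closedBall.measurableSet).2 ?_
  have : IsFiniteMeasure (volume.restrict (Metric.closedBall (0 : Spacetime) n)) :=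
    isFiniteMeasure_restrict.2 measure_closedBall_lt_top.ne
  exact (hf.restrict _).integrable (by norm_num)

lemma tendsto_eLpNorm_truncate_sub {f : Spacetime → G31} (hf : MemLp f 2) :
    Tendsto (fun n => eLpNorm (truncate n f - f) 2 volume) atTop (𝓝 0) := by
  have h : Tendsto (fun n => ∫⁻ x, ‖(truncate n f - f) x‖ₑ ^ 2) atTop
      (𝓝 (∫⁻ _ : Spacetime, 0)) := by
    refine tendsto_lintegral_of_dominated_convergence' (fun x => ‖f x‖ₑ ^ 2) (fun n => ?_)
      (fun n => ae_of_all _ fun x => ?_) ?_ (ae_of_all _ fun x => ?_)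
    · exact ((memLp_truncate hf n).sub hf).1.enorm.pow_const 2
    · refine pow_le_pow_left' ?_ 2
      by_cases hx : x ∈ Metric.closedBall (0 : Spacetime) n <;> simp [truncate, hx]
    · rw [← eLpNorm_two_sq]
      exact ENNReal.pow_ne_top hf.2.ne
    · refine tendsto_const_nhds.congr' ?_
      filter_upwards [eventually_ge_atTop ⌈‖x‖⌉₊] with n hn
      have hx : x ∈ Metric.closedBall (0 : Spacetime) n := by
        simpa using (Nat.le_ceil ‖x‖).trans (Nat.cast_le.2 hn)
      simp [truncate, hx]
  simp only [lintegral_zero, ← eLpNorm_two_sq] at h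
  have h2 := ((ENNReal.continuous_rpow_const (y := 1 / 2)).tendsto 0).comp h
  refine (h2.congr fun n => ?_).trans (by simp)
  simp only [Function.comp_apply]
  rw [← ENNReal.rpow_natCast, ← ENNReal.rpow_mul]
  norm_num

/-! ### The Fourier integral -/

lemma rotor_add (α β : ℝ) (M : G31) : rotor (α + β) M = rotor α (rotor β M) := by
  have h : et * (et * M) = -M := by rw [← mul_assoc, et_mul_et]; simp
  simp only [rotor_apply, mul_sub, mul_smul_comm, h, Real.cos_add, Real.sin_add]
  module

lemma sftIntegral_eq (v : Spacetime → G31) (ω : Spacetime) :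
    sftIntegral v ω = ∫ x : Spacetime, kernel (x 0 * ω 0) (sdot x ω) (v x) := rfl

@[fun_prop]
lemma continuous_sdot {X : Type*} [TopologicalSpace X] {x y : X → Spacetime} (hx : Continuous x)
    (hy : Continuous y) : Continuous fun z => sdot (x z) (y z) := by
  unfold sdot
  fun_prop

lemma aestronglyMeasurable_kernel {v : Spacetime → G31} (hv : AEStronglyMeasurable v)
    (ω : Spacetime) :
    AEStronglyMeasurable fun x : Spacetime => kernel (x 0 * ω 0) (sdot x ω) (v x) := by
  have h : Continuous fun p : Spacetime × G31 => kernel (p.1 0 * ω 0) (sdot p.1 ω) p.2 :=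
    continuous_kernel (by fun_prop) (by fun_prop) continuous_snd
  have hp : AEStronglyMeasurable (fun x : Spacetime => (x, v x)) :=
    continuous_id.aestronglyMeasurable.prodMk hv
  exact Continuous.comp_aestronglyMeasurable (f := fun x : Spacetime => (x, v x)) h hp

lemma integrable_kernel {v : Spacetime → G31} (hv : Integrable v) (ω : Spacetime) :
    Integrable fun x : Spacetime => kernel (x 0 * ω 0) (sdot x ω) (v x) :=
  (hv.norm.const_mul 2).mono' (aestronglyMeasurable_kernel hv.1 ω)
    (ae_of_all _ fun _ => norm_kernel_le _ _ _)

lemma continuous_sftIntegral {v : Spacetime → G31} (hv : Integrable v) :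
    Continuous (sftIntegral v) :=
  continuous_of_dominated (fun ω => aestronglyMeasurable_kernel hv.1 ω)
    (fun _ => ae_of_all _ fun _ => norm_kernel_le _ _ _) (hv.norm.const_mul 2)
    (ae_of_all _ fun x => continuous_kernel (by fun_prop) (by fun_prop) continuous_const)

lemma sftIntegral_add {v w : Spacetime → G31} (hv : Integrable v) (hw : Integrable w) :
    sftIntegral (v + w) = sftIntegral v + sftIntegral w := by
  ext ω
  simp only [sftIntegral_eq, Pi.add_apply, kernel_add]
  exact integral_add (integrable_kernel hv ω) (integrable_kernel hw ω)

lemma sftIntegral_sub {v w : Spacetime → G31} (hv : Integrable v) (hw : Integrable w) :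
    sftIntegral (v - w) = sftIntegral v - sftIntegral w := by
  ext ω
  simp only [sftIntegral_eq, Pi.sub_apply, kernel_sub]
  exact integral_sub (integrable_kernel hv ω) (integrable_kernel hw ω)

lemma sftIntegral_part (σ : ℝ) {v : Spacetime → G31} (hv : Integrable v) :
    sftIntegral (fun x => part σ (v x)) = fun ω => part σ (sftIntegral v ω) := by
  ext ω
  simp only [sftIntegral_eq, kernel_part]
  exact (part σ).integral_comp_comm (integrable_kernel hv ω)

/-- `v` takes values in the eigenspace of `M ↦ e_t M i_3` for the eigenvalue `σ`. -/
def IsPart (σ : ℝ) (v : Spacetime → G31) : Prop := ∀ x, et * v x * i3 = σ • v x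

lemma isPart_part {σ : ℝ} (hσ : σ = 1 ∨ σ = -1) (v : Spacetime → G31) :
    IsPart σ fun x => part σ (v x) :=
  fun x => et_mul_part_mul_i3 (by rcases hσ with rfl | rfl <;> norm_num) (v x)

lemma IsPart.sub {σ : ℝ} {v w : Spacetime → G31} (hv : IsPart σ v) (hw : IsPart σ w) :
    IsPart σ (v - w) := fun x => by
  rw [Pi.sub_apply, mul_sub, sub_mul, hv, hw, smul_sub]

lemma isPart_truncate {σ : ℝ} {v : Spacetime → G31} (hv : IsPart σ v) (n : ℕ) :
    IsPart σ (truncate n v) := fun x => by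
  by_cases hx : x ∈ Metric.closedBall (0 : Spacetime) n
  · simp only [truncate, Set.indicator_of_mem hx, hv x]
  · simp only [truncate, Set.indicator_of_notMem hx, mul_zero, zero_mul, smul_zero]

/-- The phase of the Fourier kernel on the eigenspace for `σ`. -/
def phase (σ : ℝ) (x ω : Spacetime) : ℝ := x 0 * ω 0 - σ * sdot x ω

lemma IsPart.sftIntegral_eq {σ : ℝ} (hσ : σ = 1 ∨ σ = -1) {v : Spacetime → G31}
    (hv : IsPart σ v) (ω : Spacetime) :
    sftIntegral v ω = ∫ x : Spacetime, rotor (phase σ x ω) (v x) := by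
  rw [STA.sftIntegral_eq]
  exact integral_congr_ae (ae_of_all _ fun x => kernel_of_part hσ _ _ (hv x))

lemma IsPart.integrable_rotor {σ : ℝ} (hσ : σ = 1 ∨ σ = -1) {v : Spacetime → G31}
    (hv : IsPart σ v) (hvi : Integrable v) (ω : Spacetime) :
    Integrable fun x : Spacetime => rotor (phase σ x ω) (v x) :=
  (integrable_kernel hvi ω).congr (ae_of_all _ fun x => kernel_of_part hσ _ _ (hv x))

/-- Rotors are additive in the angle and the phase is additive in x, so the shift factors out as one
left rotor. -/
lemma IsPart.sftIntegral_translate {σ : ℝ} (hσ : σ = 1 ∨ σ = -1) {v : Spacetime → G31}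
    (hv : IsPart σ v) (hvi : Integrable v) (h ω : Spacetime) :
    sftIntegral (fun x => v (x + h)) ω = rotor (-phase σ h ω) (sftIntegral v ω) := by
  have hvh : IsPart σ fun x => v (x + h) := fun x => hv (x + h)
  rw [hvh.sftIntegral_eq hσ, hv.sftIntegral_eq hσ,
    ← (rotor (-phase σ h ω)).integral_comp_comm (hv.integrable_rotor hσ hvi ω),
    ← integral_add_right_eq_self (fun x => rotor (-phase σ h ω) (rotor (phase σ x ω) (v x))) h]
  refine integral_congr_ae (ae_of_all _ fun x => ?_)
  simp only [← rotor_add]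
  congr 2
  simp only [phase, sdot, PiLp.add_apply]
  ring

/-! ### Plancherel's theorem for the spacetime Fourier transform -/

/-- P reflects space when σ = 1 and is the identity when σ = -1. -/
lemma exists_isometry_inner_eq_phase {σ : ℝ} (hσ : σ = 1 ∨ σ = -1) :
    ∃ P : Spacetime ≃ₗᵢ[ℝ] Spacetime, ∀ x ω, inner ℝ x (P ω) = phase σ x ω := by
  rcases hσ with rfl | rfl
  · refine ⟨LinearIsometryEquiv.piLpCongrRight 2 fun i : Fin 4 =>
      if i = 0 then LinearIsometryEquiv.refl ℝ ℝ else LinearIsometryEquiv.neg ℝ, fun x ω => ?_⟩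
    simp [PiLp.inner_apply, Fin.sum_univ_four, phase, sdot]
    ring
  · refine ⟨LinearIsometryEquiv.refl ℝ _, fun x ω => ?_⟩
    simp [PiLp.inner_apply, Fin.sum_univ_four, phase, sdot]
    ring

open FourierTransform in
lemma IsPart.complexCoords_sftIntegral {σ : ℝ} (hσ : σ = 1 ∨ σ = -1) {v : Spacetime → G31}
    (hv : IsPart σ v) (hvi : Integrable v) {P : Spacetime ≃ₗᵢ[ℝ] Spacetime}
    (hP : ∀ x ω, inner ℝ x (P ω) = phase σ x ω) (ω : Spacetime) :
    complexCoords (sftIntegral v ω) =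
      𝓕 (fun x => complexCoords (v x)) ((2 * Real.pi)⁻¹ • P ω) := by
  rw [hv.sftIntegral_eq hσ, ← complexCoords.integral_comp_comm (hv.integrable_rotor hσ hvi ω),
    Real.fourier_eq']
  refine integral_congr_ae (ae_of_all _ fun x => ?_)
  simp only [complexCoords_rotor, inner_smul_right, hP]
  congr 2
  push_cast
  field_simp

lemma eLpNorm_complexCoords (w : Spacetime → G31) :
    eLpNorm (fun x => complexCoords (w x)) 2 volume =
      ENNReal.ofReal √2 * eLpNorm w 2 volume := by
  have h : eLpNorm (fun x => complexCoords (w x)) 2 volume = eLpNorm (√2 • w) 2 volume :=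
    eLpNorm_congr_norm_ae (ae_of_all _ fun x => by
      rw [norm_complexCoords, Pi.smul_apply, norm_smul, Real.norm_of_nonneg (by positivity)])
  rw [h, eLpNorm_const_smul, Real.enorm_of_nonneg (by positivity)]

/-- The kernel of `𝓕` carries 2π in its exponent, so frequencies are rescaled by (2π)⁻¹; in
dimension 4 this contributes √((2π)⁴) = (2π)². The factors √2 of `complexCoords` cancel. -/
theorem IsPart.eLpNorm_sftIntegral {σ : ℝ} (hσ : σ = 1 ∨ σ = -1) {v : Spacetime → G31}
    (hv : IsPart σ v) (hvi : Integrable v) (hv2 : MemLp v 2) :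
    eLpNorm (sftIntegral v) 2 volume =
      ENNReal.ofReal ((2 * Real.pi) ^ 2) * eLpNorm v 2 volume := by
  obtain ⟨P, hP⟩ := exists_isometry_inner_eq_phase hσ
  have hi : Integrable fun x => complexCoords (v x) := complexCoords.integrable_comp hvi
  have h2 : MemLp (fun x => complexCoords (v x)) 2 := complexCoords.comp_memLp' hv2
  have hc := continuous_fourier_of_integrable hi
  have key : ENNReal.ofReal √2 * eLpNorm (sftIntegral v) 2 volume =
      ENNReal.ofReal √2 * (ENNReal.ofReal ((2 * Real.pi) ^ 2) * eLpNorm v 2 volume) := by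
    rw [← eLpNorm_complexCoords, mul_left_comm, ← eLpNorm_complexCoords v]
    simp only [hv.complexCoords_sftIntegral hσ hvi hP]
    have h3 := eLpNorm_comp_measurePreserving (p := 2)
      (hc.comp (continuous_const_smul (2 * Real.pi)⁻¹)).aestronglyMeasurable
      P.measurePreserving
    refine h3.trans ?_
    refine (eLpNorm_comp_smul _ Real.two_pi_pos).trans ?_
    rw [eLpNorm_fourier_eq hi h2]
    congr 2
    rw [finrank_euclideanSpace_fin, show (2 * Real.pi) ^ 4 = ((2 * Real.pi) ^ 2) ^ 2 by ring,
      Real.sqrt_sq (by positivity)]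
  exact (ENNReal.mul_right_inj (by simp) ENNReal.ofReal_ne_top).1 key

lemma part_comp_add (v : Spacetime → G31) :
    v = (fun x => part 1 (v x)) + fun x => part (-1) (v x) := by
  ext x
  exact (part_add_part_neg (v x)).symm

lemma eLpNorm_part_le {σ : ℝ} (hσ : σ = 1 ∨ σ = -1) (v : Spacetime → G31) :
    eLpNorm (fun x => part σ (v x)) 2 volume ≤ eLpNorm v 2 volume :=
  eLpNorm_mono fun x => norm_part_le (by rcases hσ with rfl | rfl <;> simp) (v x)

lemma eLpNorm_sftIntegral_le {v : Spacetime → G31} (hvi : Integrable v) (hv2 : MemLp v 2) :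
    eLpNorm (sftIntegral v) 2 volume ≤
      2 * ENNReal.ofReal ((2 * Real.pi) ^ 2) * eLpNorm v 2 volume := by
  have hi : ∀ σ, Integrable fun x => part σ (v x) := fun σ => (part σ).integrable_comp hvi
  have h2 : ∀ σ, MemLp (fun x => part σ (v x)) 2 := fun σ => (part σ).comp_memLp' hv2
  have hb : ∀ σ, σ = 1 ∨ σ = -1 → eLpNorm (sftIntegral fun x => part σ (v x)) 2 volume ≤
      ENNReal.ofReal ((2 * Real.pi) ^ 2) * eLpNorm v 2 volume := fun σ hσ => by
    rw [(isPart_part hσ v).eLpNorm_sftIntegral hσ (hi σ) (h2 σ)]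
    gcongr
    exact eLpNorm_part_le hσ v
  conv_lhs => rw [part_comp_add v, sftIntegral_add (hi _) (hi _)]
  refine (eLpNorm_add_le (continuous_sftIntegral (hi _)).aestronglyMeasurable
    (continuous_sftIntegral (hi _)).aestronglyMeasurable (by norm_num)).trans ?_
  rw [mul_assoc, two_mul]
  exact add_le_add (hb 1 (Or.inl rfl)) (hb (-1) (Or.inr rfl))

lemma memLp_sftIntegral {v : Spacetime → G31} (hvi : Integrable v) (hv2 : MemLp v 2) :
    MemLp (sftIntegral v) 2 :=
  ⟨(continuous_sftIntegral hvi).aestronglyMeasurable,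
    (eLpNorm_sftIntegral_le hvi hv2).trans_lt
      (ENNReal.mul_lt_top (ENNReal.mul_lt_top (by simp) ENNReal.ofReal_lt_top) hv2.2)⟩

/-- The transform is linear and L²-bounded on L¹ ∩ L², so the transforms of the truncations are
Cauchy in the complete space L². -/
theorem exists_isSFT {f : Spacetime → G31} (hf : MemLp f 2) : ∃ g, IsSFT f g := by
  have hi := integrable_truncate hf
  have h2 := memLp_truncate hf
  have hS := fun n => memLp_sftIntegral (hi n) (h2 n)
  have hlim : Tendsto (fun n => (h2 n).toLp (truncate n f)) atTop (𝓝 (hf.toLp f)) :=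
    (Lp.tendsto_Lp_iff_tendsto_eLpNorm'' _ _ _ _).2 (tendsto_eLpNorm_truncate_sub hf)
  have hc : CauchySeq fun n => (hS n).toLp (sftIntegral (truncate n f)) := by
    let K : NNReal := 2 * ((2 * Real.pi) ^ 2).toNNReal
    refine EMetric.cauchySeq_iff.2 fun ε hε => ?_
    have hK : (K : ℝ≥0∞) ≠ 0 := by simp [K]
    obtain ⟨N, hN⟩ := EMetric.cauchySeq_iff.1 hlim.cauchySeq (ε / K)
      (ENNReal.div_pos hε.ne' ENNReal.coe_ne_top)
    refine ⟨N, fun m hm n hn => ?_⟩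
    have h := hN m hm n hn
    rw [Lp.edist_toLp_toLp] at h ⊢
    rw [← sftIntegral_sub (hi m) (hi n)]
    refine (eLpNorm_sftIntegral_le ((hi m).sub (hi n)) ((h2 m).sub (h2 n))).trans_lt ?_
    rw [ENNReal.lt_div_iff_mul_lt (Or.inl hK) (Or.inl ENNReal.coe_ne_top), mul_comm] at h
    simpa [K, ENNReal.ofReal] using h
  obtain ⟨G, hG⟩ := cauchySeq_tendsto_of_complete hc
  refine ⟨G, Lp.memLp G, ?_⟩
  have h := (Lp.tendsto_Lp_iff_tendsto_eLpNorm' _ _).1 hG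
  refine h.congr fun n => eLpNorm_congr_ae ?_
  filter_upwards [(hS n).coeFn_toLp] with x hx
  rw [Pi.sub_apply, Pi.sub_apply, hx]
  rfl

/-! ### Limits of Fourier integrals -/

lemma isSFT_part {σ : ℝ} (hσ : σ = 1 ∨ σ = -1) {f g : Spacetime → G31} (hf : MemLp f 2)
    (hg : IsSFT f g) : IsSFT (fun x => part σ (f x)) fun ω => part σ (g ω) := by
  refine ⟨(part σ).comp_memLp' hg.1, tendsto_of_tendsto_of_tendsto_of_le_of_le tendsto_const_nhds
    hg.2 (fun _ => zero_le) fun n => ?_⟩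
  have h1 : (Metric.closedBall (0 : Spacetime) n).indicator (fun x => part σ (f x)) =
      fun x => part σ (truncate n f x) :=
    (Set.indicator_comp_of_zero (g := part σ) (map_zero _))
  have h2 : sftIntegral (fun x => part σ (truncate n f x)) - (fun ω => part σ (g ω)) =
      fun ω => part σ ((sftIntegral (truncate n f) - g) ω) := by
    rw [sftIntegral_part σ (integrable_truncate hf n)]
    ext ω
    simp only [Pi.sub_apply, map_sub]
  simp only [h1, h2]
  exact eLpNorm_part_le hσ _

/-- Plancherel for truncations, in the limit. This direction serves to deduce f = 0 from g = 0. -/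
lemma IsPart.eLpNorm_le_of_isSFT {σ : ℝ} (hσ : σ = 1 ∨ σ = -1) {f g : Spacetime → G31}
    (hp : IsPart σ f) (hf : MemLp f 2) (hg : IsSFT f g) :
    ENNReal.ofReal ((2 * Real.pi) ^ 2) * eLpNorm f 2 volume ≤ eLpNorm g 2 volume := by
  set c := ENNReal.ofReal ((2 * Real.pi) ^ 2)
  have hlim := (tendsto_const_nhds (x := eLpNorm g 2 volume)).add
    ((ENNReal.Tendsto.const_mul (a := c) (tendsto_eLpNorm_truncate_sub hf)
      (Or.inr ENNReal.ofReal_ne_top)).add hg.2)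
  simp only [mul_zero, add_zero] at hlim
  refine ge_of_tendsto' hlim fun n => ?_
  have hi := integrable_truncate hf n
  have h2 := memLp_truncate hf n
  have hS := memLp_sftIntegral hi h2
  have e1 : eLpNorm f 2 volume ≤
      eLpNorm (truncate n f) 2 volume + eLpNorm (truncate n f - f) 2 volume := by
    have := eLpNorm_sub_le (μ := volume) (p := 2) h2.1 (h2.sub hf).1 (by norm_num)
    rwa [sub_sub_cancel] at this
  have e2 : eLpNorm (sftIntegral (truncate n f)) 2 volume ≤
      eLpNorm (sftIntegral (truncate n f) - g) 2 volume + eLpNorm g 2 volume := by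
    have := eLpNorm_add_le (μ := volume) (p := 2) (hS.sub hg.1).1 hg.1.1 (by norm_num)
    rwa [sub_add_cancel] at this
  rw [(isPart_truncate hp n).eLpNorm_sftIntegral hσ hi h2] at e2
  calc c * eLpNorm f 2 volume
      ≤ c * eLpNorm (truncate n f) 2 volume + c * eLpNorm (truncate n f - f) 2 volume := by
        rw [← mul_add]; gcongr
    _ ≤ (eLpNorm (sftIntegral (truncate n f) - g) 2 volume + eLpNorm g 2 volume) +
        c * eLpNorm (truncate n f - f) 2 volume := by gcongr
    _ = _ := by
        rw [add_comm _ (eLpNorm g 2 volume), add_assoc,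
          add_comm (eLpNorm (sftIntegral (truncate n f) - g) 2 volume)]
        rfl

/-! ### Translation differences controlled by the transform. -/

@[fun_prop]
lemma continuous_phase (σ : ℝ) (h : Spacetime) : Continuous (phase σ h) := by
  unfold phase
  fun_prop

/-- With M the transform of a truncation and N its limit, the unbounded factor |θ| falls on N only;
M - N gets the uniform bound 2, so its contribution tends to 0 in L². -/
lemma norm_rotor_sub_le_add (θ : ℝ) (M N : G31) :
    ‖rotor θ M - M‖ ≤ ‖|θ| * ‖N‖ + 2 * ‖M - N‖‖ := by
  rw [Real.norm_of_nonneg (by positivity)]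
  have h : rotor θ M - M = (rotor θ N - N) + (rotor θ (M - N) - (M - N)) := by
    rw [map_sub]; abel
  rw [h, two_mul]
  refine (norm_add_le _ _).trans (add_le_add (norm_rotor_sub_le θ N) ?_)
  refine (norm_sub_le _ _).trans ?_
  rw [norm_rotor]

lemma eLpNorm_translate_sub_le_add {f v : Spacetime → G31} (h2 : MemLp v 2) (hf : MemLp f 2)
    (h : Spacetime) : eLpNorm (fun x => f (x + h) - f x) 2 volume ≤
      eLpNorm ((fun x => v (x + h)) - v) 2 volume + 2 * eLpNorm (v - f) 2 volume := by
  have h2h : MemLp (fun x => v (x + h)) 2 := memLp_comp_add_right h2 h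
  have hd : MemLp (v - f) 2 := h2.sub hf
  have hdh : MemLp (fun x => (v - f) (x + h)) 2 := memLp_comp_add_right hd h
  have h3 : (fun x => f (x + h) - f x) =
      ((fun x => v (x + h)) - v) - ((fun x => (v - f) (x + h)) - (v - f)) := by
    ext x
    simp only [Pi.sub_apply]
    abel
  rw [h3]
  refine (eLpNorm_sub_le (h2h.sub h2).1 (hdh.sub hd).1 (by norm_num)).trans ?_
  gcongr
  refine (eLpNorm_sub_le hdh.1 hd.1 (by norm_num)).trans ?_
  rw [eLpNorm_comp_add_right hd.1 h, two_mul]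

lemma IsPart.eLpNorm_translate_sub_le_eLpNorm_add {σ : ℝ} (hσ : σ = 1 ∨ σ = -1)
    {v g : Spacetime → G31} (hpv : IsPart σ v) (hi : Integrable v) (h2 : MemLp v 2) (hg : MemLp g 2)
    (h : Spacetime) :
    ENNReal.ofReal ((2 * Real.pi) ^ 2) * eLpNorm ((fun x => v (x + h)) - v) 2 volume ≤
      eLpNorm (fun ω => phase σ h ω • g ω) 2 volume +
        2 * eLpNorm (sftIntegral v - g) 2 volume := by
  have hS : MemLp (sftIntegral v) 2 := memLp_sftIntegral hi h2
  have hih : Integrable fun x => v (x + h) := hi.comp_add_right h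
  have h2h : MemLp (fun x => v (x + h)) 2 := memLp_comp_add_right h2 h
  have hpd : IsPart σ ((fun x => v (x + h)) - v) :=
    IsPart.sub (fun x => hpv (x + h)) hpv
  rw [← hpd.eLpNorm_sftIntegral hσ (hih.sub hi) (h2h.sub h2), sftIntegral_sub hih hi]
  have m1 : AEStronglyMeasurable fun ω => phase σ h ω • g ω :=
    (continuous_phase σ h).aestronglyMeasurable.smul hg.1
  have m2 := (hS.sub hg).1
  calc eLpNorm (sftIntegral (fun x => v (x + h)) - sftIntegral v) 2 volume
      ≤ eLpNorm ((fun ω => ‖phase σ h ω • g ω‖) +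
          (2 : ℝ) • fun ω => ‖(sftIntegral v - g) ω‖) 2 volume := by
        refine eLpNorm_mono fun ω => ?_
        rw [Pi.sub_apply, hpv.sftIntegral_translate hσ hi]
        have := norm_rotor_sub_le_add (-phase σ h ω) (sftIntegral v ω) (g ω)
        simpa [norm_smul] using this
    _ ≤ _ := by
        refine (eLpNorm_add_le m1.norm (m2.norm.const_smul _) (by norm_num)).trans ?_
        have h2e : ‖(2 : ℝ)‖ₑ = 2 := by simp [Real.enorm_of_nonneg]
        rw [eLpNorm_norm, eLpNorm_const_smul, eLpNorm_norm, h2e]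

/-- The `L²` modulus of continuity of `f` is controlled by its Fourier transform. -/
theorem IsPart.eLpNorm_translate_sub_le {σ : ℝ} (hσ : σ = 1 ∨ σ = -1) {f g : Spacetime → G31}
    (hp : IsPart σ f) (hf : MemLp f 2) (hg : IsSFT f g) (h : Spacetime) :
    ENNReal.ofReal ((2 * Real.pi) ^ 2) * eLpNorm (fun x => f (x + h) - f x) 2 volume ≤
      eLpNorm (fun ω => phase σ h ω • g ω) 2 volume := by
  set c := ENNReal.ofReal ((2 * Real.pi) ^ 2)
  have hlim := (tendsto_const_nhds (x := eLpNorm (fun ω => phase σ h ω • g ω) 2 volume)).add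
    ((ENNReal.Tendsto.const_mul (a := 2) hg.2 (Or.inr (by norm_num))).add
    (ENNReal.Tendsto.const_mul (a := c) (ENNReal.Tendsto.const_mul (a := 2)
      (tendsto_eLpNorm_truncate_sub hf) (Or.inr (by norm_num))) (Or.inr ENNReal.ofReal_ne_top)))
  simp only [mul_zero, add_zero] at hlim
  refine ge_of_tendsto' hlim fun n => ?_
  change _ ≤ _ + (2 * eLpNorm (sftIntegral (truncate n f) - g) 2 volume + _)
  set v := truncate n f with hvdef
  have hi : Integrable v := integrable_truncate hf n
  have h2 : MemLp v 2 := memLp_truncate hf n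
  have hpv : IsPart σ v := isPart_truncate hp n
  have e1 := eLpNorm_translate_sub_le_add h2 hf h
  have e2 := hpv.eLpNorm_translate_sub_le_eLpNorm_add hσ hi h2 hg.1 h
  calc c * eLpNorm (fun x => f (x + h) - f x) 2 volume
      ≤ c * eLpNorm ((fun x => v (x + h)) - v) 2 volume +
          c * (2 * eLpNorm (v - f) 2 volume) := by
        rw [← mul_add]; gcongr
    _ ≤ _ := by
        rw [← add_assoc]
        gcongr

/-! ### The uncertainty principle -/

/-- The linear form `x ↦ a_t t - a⃗ · x⃗`. -/
def linForm (a : Spacetime) : Spacetime →L[ℝ] ℝ :=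
  LinearMap.toContinuousLinearMap
    { toFun := fun x => a 0 * x 0 - sdot a x
      map_add' := fun x y => by simp only [sdot, PiLp.add_apply]; ring
      map_smul' := fun c x => by
        simp only [sdot, PiLp.smul_apply, smul_eq_mul, RingHom.id_apply]; ring }

lemma linForm_apply (a x : Spacetime) : linForm a x = a 0 * x 0 - sdot a x := rfl

lemma dirVar_eq (a : Spacetime) (g : Spacetime → G31) :
    dirVar a g = eLpNorm (fun x => linForm a x • g x) 2 volume ^ 2 := by
  rw [eLpNorm_two_sq, dirVar]
  refine lintegral_congr fun x => ?_
  rw [← ofReal_norm, ← ENNReal.ofReal_pow (norm_nonneg _), norm_smul, mul_pow, Real.norm_eq_abs,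
    sq_abs, linForm_apply]

/-- The kernel of a nonzero linear form is a proper subspace, hence null. -/
lemma ae_eq_zero_of_eLpNorm_linear_smul {L : Spacetime →L[ℝ] ℝ} {x₀ : Spacetime} (hL : L x₀ ≠ 0)
    {g : Spacetime → G31} (hg : AEStronglyMeasurable g)
    (h : eLpNorm (fun x => L x • g x) 2 volume = 0) : g =ᵐ[volume] 0 := by
  have hm : AEStronglyMeasurable fun x => L x • g x := L.continuous.aestronglyMeasurable.smul hg
  have h0 := (eLpNorm_eq_zero_iff hm (by norm_num)).1 h
  have hker : volume ((LinearMap.ker L.toLinearMap : Submodule ℝ Spacetime) : Set Spacetime) = 0 :=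
    Measure.addHaar_submodule _ _ fun ht => hL (by
      have : x₀ ∈ LinearMap.ker L.toLinearMap := ht ▸ Submodule.mem_top
      simpa using this)
  filter_upwards [h0, measure_eq_zero_iff_ae_notMem.1 hker] with x hx hx'
  exact (smul_eq_zero.1 hx).resolve_left fun hLx => hx' (by simpa using hLx)

lemma energy_eq_zero {f : Spacetime → G31} (hf : f =ᵐ[volume] 0) : energy f = 0 := by
  refine integral_eq_zero_of_ae ?_
  filter_upwards [hf] with x hx
  simp [hx]

/-- Time-preserving rescaling of the spatial part of a spacetime vector. -/
def scaleSpace (σ : ℝ) (b : Spacetime) : Spacetime :=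
  !₂[b 0, σ * b 1, σ * b 2, σ * b 3]

lemma linForm_scaleSpace (σ : ℝ) (a b : Spacetime) :
    linForm a (scaleSpace σ b) = a 0 * b 0 - σ * sdot a b := by
  simp [linForm_apply, scaleSpace, sdot]
  ring

lemma linForm_scaleSpace_comm (σ : ℝ) (a b : Spacetime) :
    linForm a (scaleSpace σ b) = linForm b (scaleSpace σ a) := by
  simp only [linForm_scaleSpace, sdot]
  ring

/-- This dictates the translation direction: σ² = 1 cancels the sign in the phase. -/
lemma phase_smul_scaleSpace {σ : ℝ} (hσ : σ = 1 ∨ σ = -1) (s : ℝ) (b ω : Spacetime) :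
    phase σ (s • scaleSpace σ b) ω = s * linForm b ω := by
  rcases hσ with rfl | rfl <;> simp [phase, linForm_apply, scaleSpace, sdot] <;> ring

lemma IsPart.linForm_mul_energy_le {σ : ℝ} (hσ : σ = 1 ∨ σ = -1) {f g : Spacetime → G31}
    (hp : IsPart σ f) (hf : MemLp f 2) (hg : IsSFT f g) (a b : Spacetime)
    (hA : eLpNorm (fun x => linForm a x • f x) 2 volume ≠ ∞)
    (hB : eLpNorm (fun ω => linForm b ω • g ω) 2 volume ≠ ∞) :
    (2 * Real.pi) ^ 2 * (|linForm a (scaleSpace σ b)| * energy f) ≤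
      2 * ((eLpNorm (fun x => linForm a x • f x) 2 volume).toReal *
        (eLpNorm (fun ω => linForm b ω • g ω) 2 volume).toReal) := by
  set B := eLpNorm (fun ω => linForm b ω • g ω) 2 volume
  -- The uncertainty lemma needs an inner product on the target, so f is read in blade coefficients,
  -- isometrically.
  let T : G31 →L[ℝ] EuclideanSpace ℝ (Finset (Fin 4)) :=
    LinearMap.toContinuousLinearMap coeffs.toLinearMap
  have hT : ∀ M, ‖T M‖ = ‖M‖ := norm_coeffs
  have hTL : ∀ u : Spacetime → G31, eLpNorm (fun x => T (u x)) 2 volume = eLpNorm u 2 volume :=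
    fun u => eLpNorm_congr_norm_ae (ae_of_all _ fun x => hT (u x))
  have hαf : MemLp (fun x => linForm a x • f x) 2 :=
    ⟨(linForm a).continuous.aestronglyMeasurable.smul hf.1, hA.lt_top⟩
  have hαTf : (fun x => linForm a x • T (f x)) = fun x => T (linForm a x • f x) := by
    ext1 x; rw [map_smul]
  have key := abs_mul_integral_norm_sq_le (u := fun x => T (f x)) (linForm a)
    (T.comp_memLp' hf) (hαTf ▸ T.comp_memLp' hαf) (scaleSpace σ b)
    (C := ((2 * Real.pi) ^ 2)⁻¹ * B.toReal) fun s => by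
      have h1 := hp.eLpNorm_translate_sub_le hσ hf hg (s • scaleSpace σ b)
      have h2 : (fun ω => phase σ (s • scaleSpace σ b) ω • g ω) =
          s • fun ω => linForm b ω • g ω := by
        ext1 ω
        rw [phase_smul_scaleSpace hσ, mul_smul]; rfl
      rw [h2, eLpNorm_const_smul] at h1
      have h3 := ENNReal.toReal_mono (ENNReal.mul_ne_top (by simp) hB) h1
      rw [ENNReal.toReal_mul, ENNReal.toReal_mul, ENNReal.toReal_ofReal (by positivity),
        toReal_enorm, Real.norm_eq_abs] at h3
      simp only [← map_sub]
      rw [hTL, mul_left_comm, ← div_eq_inv_mul, le_div_iff₀ (by positivity), mul_comm]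
      exact h3
  simp only [hT] at key
  rw [hαTf, hTL, mul_assoc] at key
  have := mul_le_mul_of_nonneg_left key (by positivity : (0 : ℝ) ≤ (2 * Real.pi) ^ 2)
  refine this.trans_eq ?_
  field_simp

theorem IsPart.dirVar_mul_dirVar_ge {σ : ℝ} (hσ : σ = 1 ∨ σ = -1) {f g : Spacetime → G31}
    (hp : IsPart σ f) (hf : MemLp f 2) (hg : IsSFT f g) (a b : Spacetime) :
    ENNReal.ofReal ((2 * Real.pi) ^ 4 / 4 *
      ((a 0 * b 0 - σ * sdot a b) ^ 2 * energy f ^ 2)) ≤ dirVar a f * dirVar b g := by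
  rw [dirVar_eq, dirVar_eq, ← linForm_scaleSpace]
  have key := hp.linForm_mul_energy_le hσ hf hg a b
  set A := eLpNorm (fun x => linForm a x • f x) 2 volume with hAdef
  set B := eLpNorm (fun ω => linForm b ω • g ω) 2 volume with hBdef
  set l := linForm a (scaleSpace σ b) with hl
  by_cases hl0 : l = 0
  · simp [hl0]
  have hE : 0 ≤ energy f := integral_nonneg fun x => by positivity
  -- Because 0·∞ = 0, a vanishing variance must be shown to force zero energy before the infinite
  -- cases are dismissed.
  have hA0 : A = 0 → energy f = 0 := fun h =>
    energy_eq_zero (ae_eq_zero_of_eLpNorm_linear_smul hl0 hf.1 h)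
  have hB0 : B = 0 → energy f = 0 := fun h => by
    rw [hl, linForm_scaleSpace_comm] at hl0
    have hg0 := ae_eq_zero_of_eLpNorm_linear_smul hl0 hg.1.1 h
    have h1 := hp.eLpNorm_le_of_isSFT hσ hf hg
    rw [eLpNorm_congr_ae hg0, eLpNorm_zero, nonpos_iff_eq_zero, mul_eq_zero] at h1
    have h2 := h1.resolve_left (by simp)
    exact energy_eq_zero ((eLpNorm_eq_zero_iff hf.1 (by norm_num)).1 h2)
  by_cases hE0 : energy f = 0
  · simp [hE0]
  have hA0' : A ≠ 0 := mt hA0 hE0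
  have hB0' : B ≠ 0 := mt hB0 hE0
  by_cases hA : A = ∞
  · simp [hA, ENNReal.top_mul, hB0']
  by_cases hB : B = ∞
  · simp [hB, ENNReal.mul_top, hA0']
  have h := key hA hB
  rw [← mul_pow A B, ← ENNReal.ofReal_toReal (ENNReal.pow_ne_top (ENNReal.mul_ne_top hA hB))]
  refine ENNReal.ofReal_le_ofReal ?_
  rw [ENNReal.toReal_pow, ENNReal.toReal_mul]
  have h' := pow_le_pow_left₀ (by positivity) h 2
  rw [← sq_abs l]
  nlinarith [h']

/-- The integrands agree pointwise by orthogonality of the parts; superadditivity of the lower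
integral then needs no measurability. -/
lemma dirVar_part_add_le (a : Spacetime) (g : Spacetime → G31) :
    dirVar a (fun x => part 1 (g x)) + dirVar a (fun x => part (-1) (g x)) ≤ dirVar a g := by
  refine (le_lintegral_add _ _).trans_eq (lintegral_congr fun x => ?_)
  rw [← ENNReal.ofReal_add (by positivity) (by positivity), ← mul_add, norm_sq_part_add]

end STA

end

theorem mainTheorem2 (a b : STA.Spacetime) (f : STA.Spacetime → STA.G31)
    (hf : MeasureTheory.MemLp f 2 MeasureTheory.volume)
    (hxf : MeasureTheory.MemLp (fun x : STA.Spacetime => ‖x‖ ^ (1 / 2 : ℝ) • f x) 2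
      MeasureTheory.volume) :
    (∃ g : STA.Spacetime → STA.G31, STA.IsSFT f g) ∧
    ∀ g : STA.Spacetime → STA.G31, STA.IsSFT f g →
      STA.dirVar a f * STA.dirVar b g ≥
        ENNReal.ofReal ((2 * Real.pi) ^ 4 / 4 *
          ((a 0 * b 0 + STA.sdot a b) ^ 2 * STA.energy (STA.minusPart f) ^ 2 +
            (a 0 * b 0 - STA.sdot a b) ^ 2 * STA.energy (STA.plusPart f) ^ 2)) := by
  refine ⟨STA.exists_isSFT hf, fun g hg => ?_⟩
  have h : ∀ σ : ℝ, σ = 1 ∨ σ = -1 → ENNReal.ofReal ((2 * Real.pi) ^ 4 / 4 *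
      ((a 0 * b 0 - σ * STA.sdot a b) ^ 2 * STA.energy (fun x => STA.part σ (f x)) ^ 2)) ≤
      STA.dirVar a (fun x => STA.part σ (f x)) * STA.dirVar b (fun ω => STA.part σ (g ω)) :=
    fun σ hσ => (STA.isPart_part hσ f).dirVar_mul_dirVar_ge hσ ((STA.part σ).comp_memLp' hf)
      (STA.isSFT_part hσ hf hg) a b
  have h1 := h 1 (Or.inl rfl)
  have h2 := h (-1) (Or.inr rfl)
  rw [one_mul, ← STA.plusPart_eq] at h1
  rw [neg_one_mul, sub_neg_eq_add, ← STA.minusPart_eq] at h2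
  have ha := STA.dirVar_part_add_le a f
  have hb := STA.dirVar_part_add_le b g
  rw [← STA.plusPart_eq, ← STA.minusPart_eq] at ha hb
  rw [← STA.plusPart_eq] at h1
  rw [← STA.minusPart_eq] at h2
  rw [ge_iff_le, mul_add, ENNReal.ofReal_add (by positivity) (by positivity)]
  calc _ ≤ STA.dirVar a (STA.minusPart f) * STA.dirVar b (STA.minusPart g) +
        STA.dirVar a (STA.plusPart f) * STA.dirVar b (STA.plusPart g) := add_le_add h2 h1
    -- The mixed plus-minus products are nonnegative and are discarded.
    _ ≤ (STA.dirVar a (STA.plusPart f) + STA.dirVar a (STA.minusPart f)) *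
        (STA.dirVar b (STA.plusPart g) + STA.dirVar b (STA.minusPart g)) := by
        rw [add_mul, mul_add, mul_add, add_comm]
        exact add_le_add le_self_add le_add_self
    _ ≤ _ := mul_le_mul' ha hb
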